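/- Let $H$ be a complex Hilbert space with inner product $(\cdot\mid\cdot)$, linear in the first variable, let $T$ be a bounded linear operator on $H$, let $I$ be the identity operator on $H$, and let $\varepsilon\in[0,1)$. Let $\mathbb{B}(H)$ be the algebra of bounded linear operators on $H$ with the operator norm. For $x,y$ in a complex normed space, write $x\parallel^{\varepsilon}y$ if $\inf\{\|x+\mu y\|:\mu\in\mathbb{C}\}\le\varepsilon\|x\|$. Let $\delta_T:\mathbb{B}(H)\to\mathbb{B}(H)$, $\delta_T(S)=TS-ST$, be the inner derivation given by $T$, and let $\|\delta_T\|$ be its operator norm. Then the following statements are equivalent: (i) $T\parallel^{\varepsilon} I$ in $\mathbb{B}(H)$; (ii) $\sup\{\|T\xi-(T\xi\mid\xi)\xi\|:\ \xi\in H,\ \|\xi\|=1\}\le\varepsilon\|T\|$; (iii) $\sup\{\|T\xi\|^2-|(T\xi\mid\xi)|^2:\ \xi\in H,\ \|\xi\|=1\}\le\varepsilon^2\|T\|^2$; (iv) $\|\delta_T\|\le2\varepsilon\|T\|$. (If $H=\{0\}$, the suprema over the empty set are taken to be $0$.) -/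

import Mathlib

/-- `x` is `ε`-parallel to `y` in a complex normed space: `inf {‖x + μ y‖ : μ ∈ ℂ} ≤ ε ‖x‖`. -/
def ApproxParallel {V : Type*} [NormedAddCommGroup V] [NormedSpace ℂ V]
    (ε : ℝ) (x y : V) : Prop :=
  sInf {r : ℝ | ∃ μ : ℂ, r = ‖x + μ • y‖} ≤ ε * ‖x‖

/-- The inner derivation `S ↦ T S - S T`, as a bounded operator on the Banach space of bounded
operators on `H`; its norm is the operator norm. -/
noncomputable def innerDerivation {H : Type*} [NormedAddCommGroup H] [InnerProductSpace ℂ H]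
    (T : H →L[ℂ] H) : (H →L[ℂ] H) →L[ℂ] (H →L[ℂ] H) :=
  ContinuousLinearMap.mul ℂ (H →L[ℂ] H) T - (ContinuousLinearMap.mul ℂ (H →L[ℂ] H)).flip T

theorem innerDerivation_apply {H : Type*} [NormedAddCommGroup H] [InnerProductSpace ℂ H]
    (T S : H →L[ℂ] H) : innerDerivation T S = T * S - S * T := rfl

open scoped InnerProductSpace ComplexConjugate

section Variance

variable {H : Type*} [NormedAddCommGroup H] [InnerProductSpace ℂ H]

/-! By Pythagoras the defect `‖T ξ - ⟪ξ, T ξ⟫ • ξ‖ ^ 2` is the variance in (iii). The derivation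
kills scalars, so its norm is at most `2 * ‖T + μ • I‖` for every `μ`; a reflection bounds it below
by twice any defect.

The hard part is a scalar bringing `T` within the largest defect `M`. Take `S = T + μ • I` of least
norm and suppose `‖S‖ > M`. Unit vectors with `‖S ξ‖` near `‖S‖` have numerical values bounded away
from 0. These values form a convex set, so its closure has a nonzero point nearest 0, and
subtracting a small multiple of that point from `S` lowers the norm, a contradiction. -/

theorem norm_sub_smul_sq (T : H →L[ℂ] H) (ξ : H) (hξ : ‖ξ‖ = 1) (w : ℂ) :
    ‖T ξ - w • ξ‖ ^ 2 = ‖T ξ‖ ^ 2 - 2 * (conj w * ⟪ξ, T ξ⟫_ℂ).re + ‖w‖ ^ 2 := by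
  rw [@norm_sub_sq ℂ, norm_smul, hξ, mul_one, inner_re_symm, inner_smul_left,
    RCLike.re_to_complex]

theorem norm_sub_inner_smul_sq (T : H →L[ℂ] H) (ξ : H) (hξ : ‖ξ‖ = 1) :
    ‖T ξ - ⟪ξ, T ξ⟫_ℂ • ξ‖ ^ 2 = ‖T ξ‖ ^ 2 - ‖⟪ξ, T ξ⟫_ℂ‖ ^ 2 := by
  rw [norm_sub_smul_sq T ξ hξ, Complex.conj_mul', ← Complex.ofReal_pow, Complex.ofReal_re]
  ring

theorem norm_sub_inner_smul_le (T : H →L[ℂ] H) (ξ : H) (hξ : ‖ξ‖ = 1) :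
    ‖T ξ - ⟪ξ, T ξ⟫_ℂ • ξ‖ ≤ ‖T‖ := by
  have h1 := norm_sub_inner_smul_sq T ξ hξ
  have h2 : ‖T ξ‖ ≤ ‖T‖ := by simpa [hξ] using T.le_opNorm ξ
  have h3 : ‖T ξ - ⟪ξ, T ξ⟫_ℂ • ξ‖ ≤ ‖T ξ‖ :=
    abs_le_of_sq_le_sq' (by rw [h1]; linarith [sq_nonneg ‖⟪ξ, T ξ⟫_ℂ‖]) (norm_nonneg _) |>.2
  exact h3.trans h2

/-! ### Toeplitz–Hausdorff convexity under a norm constraint -/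

theorem exists_unit_im_mul_eq_zero (z : ℂ) : ∃ u : ℂ, ‖u‖ = 1 ∧ (u * z).im = 0 := by
  by_cases hz : z = 0
  · exact ⟨1, by simp, by simp [hz]⟩
  · have hn : ‖z‖ ≠ 0 := norm_ne_zero_iff.2 hz
    refine ⟨conj z / (‖z‖ : ℂ), by simp [hn], ?_⟩
    rw [div_mul_eq_mul_div, Complex.conj_mul', ← Complex.ofReal_pow, ← Complex.ofReal_div,
      Complex.ofReal_im]

/-- Along the real segment from `η` to `ξ` the numerical range of `R` takes every value in
`[0, 1]`, provided that the cross terms are real; the bound `c ≤ ‖S ζ‖ ^ 2` persists when the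
cross term of the form `‖S ζ‖ ^ 2 - c * ‖ζ‖ ^ 2` is nonnegative. -/
theorem exists_unit_inner_eq_of_cross_real (R S : H →L[ℂ] H) {ξ η : H} {c t : ℝ}
    (hξ : ‖ξ‖ = 1) (hη : ‖η‖ = 1) (hRξ : ⟪ξ, R ξ⟫_ℂ = 1) (hRη : ⟪η, R η⟫_ℂ = 0)
    (him : (⟪ξ, R η⟫_ℂ + ⟪η, R ξ⟫_ℂ).im = 0)
    (hre : 0 ≤ (⟪S ξ, S η⟫_ℂ - c * ⟪ξ, η⟫_ℂ).re)
    (hSξ : c ≤ ‖S ξ‖ ^ 2) (hSη : c ≤ ‖S η‖ ^ 2) (ht : t ∈ Set.Icc (0 : ℝ) 1) :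
    ∃ ζ : H, ‖ζ‖ = 1 ∧ ⟪ζ, R ζ⟫_ℂ = t ∧ c ≤ ‖S ζ‖ ^ 2 := by
  set m : ℝ := (⟪ξ, R η⟫_ℂ + ⟪η, R ξ⟫_ℂ).re with hm
  have hm' : ⟪ξ, R η⟫_ℂ + ⟪η, R ξ⟫_ℂ = (m : ℂ) := Complex.ext (by simp [hm]) (by simpa using him)
  let v : ℝ → H := fun s => (s : ℂ) • ξ + ((1 - s : ℝ) : ℂ) • η
  have hR : ∀ s : ℝ, ⟪v s, R (v s)⟫_ℂ = ((s ^ 2 + s * (1 - s) * m : ℝ) : ℂ) := by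
    intro s
    simp only [v, map_add, map_smul, inner_add_left, inner_add_right, inner_smul_left,
      inner_smul_right, hRξ, hRη, Complex.conj_ofReal]
    push_cast
    rw [← hm']
    ring
  have hS : ∀ s : ℝ, ‖S (v s)‖ ^ 2 - c * ‖v s‖ ^ 2 = s ^ 2 * (‖S ξ‖ ^ 2 - c)
      + (1 - s) ^ 2 * (‖S η‖ ^ 2 - c)
      + 2 * (s * (1 - s)) * (⟪S ξ, S η⟫_ℂ - c * ⟪ξ, η⟫_ℂ).re := by
    intro s
    simp only [v, map_add, map_smul]
    rw [@norm_add_sq ℂ, @norm_add_sq ℂ]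
    simp only [norm_smul, inner_smul_left, inner_smul_right, Complex.conj_ofReal, mul_pow,
      Complex.norm_real, Real.norm_eq_abs, sq_abs, hξ, hη, RCLike.re_to_complex,
      Complex.re_ofReal_mul, Complex.sub_re]
    ring
  have hcont : Continuous fun s : ℝ => s ^ 2 + s * (1 - s) * m - t * ‖v s‖ ^ 2 := by
    simp only [v]; fun_prop
  obtain ⟨s, ⟨hs0, hs1⟩, hs⟩ : (0 : ℝ) ∈ (fun s : ℝ => s ^ 2 + s * (1 - s) * m - t * ‖v s‖ ^ 2) ''
      Set.Icc 0 1 := by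
    apply intermediate_value_Icc zero_le_one hcont.continuousOn
    simp [v, hξ, hη, ht.1, ht.2]
  have hv : v s ≠ 0 := by
    intro h0
    have h1 : (s : ℂ) • ξ = -(((1 - s : ℝ) : ℂ) • η) := eq_neg_of_add_eq_zero_left h0
    have h2 : ⟪(s : ℂ) • ξ, R ((s : ℂ) • ξ)⟫_ℂ = 0 := by
      rw [h1]; simp [inner_smul_left, inner_smul_right, hRη]
    have hs00 : s = 0 := by
      simpa [inner_smul_left, inner_smul_right, hRξ] using h2
    have : η = 0 := by simpa [v, hs00] using h0
    simp [this] at hη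
  have hn : ‖v s‖ ≠ 0 := norm_ne_zero_iff.2 hv
  refine ⟨((‖v s‖⁻¹ : ℝ) : ℂ) • v s, ?_, ?_, ?_⟩
  · simp [norm_smul, hn]
  · have : s ^ 2 + s * (1 - s) * m = t * ‖v s‖ ^ 2 := sub_eq_zero.1 hs
    rw [map_smul, inner_smul_left, inner_smul_right, hR, this, Complex.conj_ofReal,
      ← Complex.ofReal_mul, ← Complex.ofReal_mul]
    congr 1
    field_simp
  · have h1 : 0 ≤ ‖S (v s)‖ ^ 2 - c * ‖v s‖ ^ 2 := by
      rw [hS]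
      have := sub_nonneg.2 hSξ
      have := sub_nonneg.2 hSη
      have := sub_nonneg.2 hs1
      positivity
    rw [map_smul, norm_smul, mul_pow, Complex.norm_real, norm_inv, norm_norm, inv_pow,
      inv_mul_eq_div, le_div_iff₀ (by positivity)]
    linarith

/-- A phase `u` on `η` makes the cross terms of `R` real. So does `-u`, and this free sign makes the
cross term of `S` nonnegative. -/
theorem exists_unit_inner_eq (R S : H →L[ℂ] H) {ξ η : H} {c t : ℝ}
    (hξ : ‖ξ‖ = 1) (hη : ‖η‖ = 1) (hRξ : ⟪ξ, R ξ⟫_ℂ = 1) (hRη : ⟪η, R η⟫_ℂ = 0)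
    (hSξ : c ≤ ‖S ξ‖ ^ 2) (hSη : c ≤ ‖S η‖ ^ 2) (ht : t ∈ Set.Icc (0 : ℝ) 1) :
    ∃ ζ : H, ‖ζ‖ = 1 ∧ ⟪ζ, R ζ⟫_ℂ = t ∧ c ≤ ‖S ζ‖ ^ 2 := by
  obtain ⟨u, hu, huz⟩ := exists_unit_im_mul_eq_zero (⟪ξ, R η⟫_ℂ - conj ⟪η, R ξ⟫_ℂ)
  wlog hre : 0 ≤ (u * (⟪S ξ, S η⟫_ℂ - c * ⟪ξ, η⟫_ℂ)).re generalizing u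
  · refine this (-u) (by simpa using hu) (by rw [neg_mul, Complex.neg_im, huz, neg_zero]) ?_
    rw [neg_mul, Complex.neg_re]
    linarith
  refine exists_unit_inner_eq_of_cross_real R S (η := u • η) hξ (by simp [norm_smul, hu, hη]) hRξ
    (by simp [hRη]) ?_ ?_ hSξ
    (by simpa [norm_smul, hu] using hSη) ht
  · rw [map_smul, inner_smul_left, inner_smul_right]
    simp only [Complex.mul_im, Complex.add_im, Complex.sub_im, Complex.sub_re, Complex.conj_re,
      Complex.conj_im] at huz ⊢
    linarith
  · rw [map_smul, inner_smul_right, inner_smul_right]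
    convert hre using 2
    ring

/-- The values of the numerical range of `S` at the unit vectors on which `‖S ξ‖ ^ 2 ≥ c`. -/
def upperNumericalRange (S : H →L[ℂ] H) (c : ℝ) : Set ℂ :=
  {w | ∃ ξ : H, ‖ξ‖ = 1 ∧ c ≤ ‖S ξ‖ ^ 2 ∧ w = ⟪ξ, S ξ⟫_ℂ}

theorem convex_upperNumericalRange (S : H →L[ℂ] H) (c : ℝ) :
    Convex ℝ (upperNumericalRange S c) := by
  rintro _ ⟨ξ, hξ, hSξ, rfl⟩ _ ⟨η, hη, hSη, rfl⟩ a b ha hb hab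
  set p := ⟪ξ, S ξ⟫_ℂ with hp
  set q := ⟪η, S η⟫_ℂ with hq
  by_cases hpq : p = q
  · refine ⟨ξ, hξ, hSξ, ?_⟩
    rw [← hpq, ← add_smul, hab, one_smul]
  have hd : p - q ≠ 0 := sub_ne_zero.2 hpq
  -- An affine change of `S` sends `p` to 1 and `q` to 0; the norm constraint keeps the original
  -- `S`.
  have hR : ∀ ζ : H, ‖ζ‖ = 1 →
      ⟪ζ, ((p - q)⁻¹ • (S - q • ContinuousLinearMap.id ℂ H)) ζ⟫_ℂ
        = (p - q)⁻¹ * (⟪ζ, S ζ⟫_ℂ - q) := by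
    intro ζ hζ
    simp [inner_self_eq_norm_sq_to_K, hζ]
  obtain ⟨ζ, hζ, hRζ, hSζ⟩ := exists_unit_inner_eq
    ((p - q)⁻¹ • (S - q • ContinuousLinearMap.id ℂ H)) S hξ hη
    (by rw [hR ξ hξ, ← hp, inv_mul_cancel₀ hd]) (by rw [hR η hη, ← hq, sub_self, mul_zero])
    hSξ hSη (t := a) ⟨ha, by linarith⟩
  refine ⟨ζ, hζ, hSζ, ?_⟩
  rw [hR ζ hζ, inv_mul_eq_iff_eq_mul₀ hd, sub_eq_iff_eq_add] at hRζ
  rw [hRζ, ← eq_sub_iff_add_eq'] at *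
  subst hab
  simp only [Complex.real_smul]
  push_cast
  ring

/-! ### Distance to the scalars -/

theorem exists_norm_sub_smul_id_lt (S : H →L[ℂ] H) {M : ℝ} (hM : 0 ≤ M) (hMS : M < ‖S‖)
    (h : ∀ ξ : H, ‖ξ‖ = 1 → ‖S ξ‖ ^ 2 - ‖⟪ξ, S ξ⟫_ℂ‖ ^ 2 ≤ M ^ 2) :
    ∃ w : ℂ, ‖S - w • ContinuousLinearMap.id ℂ H‖ < ‖S‖ := by
  have hsq : M ^ 2 < ‖S‖ ^ 2 := by gcongr
  obtain ⟨c, hc1, hc2⟩ := exists_between hsq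
  have hc0 : 0 ≤ c := (sq_nonneg M).trans hc1.le
  have hbound : ∀ (A : H →L[ℂ] H) (K : ℝ), 0 ≤ K → (∀ ξ : H, ‖ξ‖ = 1 → ‖A ξ‖ ^ 2 ≤ K) →
      ‖A‖ ^ 2 ≤ K := by
    intro A K hK hA
    rw [← Real.le_sqrt (norm_nonneg _) hK]
    exact A.opNorm_le_of_unit_norm (Real.sqrt_nonneg K) fun ξ hξ => Real.le_sqrt_of_sq_le (hA ξ hξ)
  have hne : (closure (upperNumericalRange S c)).Nonempty := by
    by_contra hemp
    rw [closure_nonempty_iff, Set.not_nonempty_iff_eq_empty] at hemp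
    refine hc2.not_ge (hbound S c hc0 fun ξ hξ => ?_)
    by_contra hlt
    have : ⟪ξ, S ξ⟫_ℂ ∈ upperNumericalRange S c := ⟨ξ, hξ, (not_le.1 hlt).le, rfl⟩
    simp [hemp] at this
  have hconv : Convex ℝ (closure (upperNumericalRange S c)) :=
    (convex_upperNumericalRange S c).closure
  obtain ⟨w, hw, hmin⟩ := exists_norm_eq_iInf_of_complete_convex hne
    isClosed_closure.isComplete hconv 0
  have hinner := (norm_eq_iInf_iff_real_inner_le_zero hconv hw).1 hmin
  have hwpos : 0 < ‖w‖ := by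
    have hsub : closure (upperNumericalRange S c) ⊆ {z : ℂ | c - M ^ 2 ≤ ‖z‖ ^ 2} := by
      refine closure_minimal ?_ (isClosed_le continuous_const (by fun_prop))
      rintro _ ⟨ξ, hξ, hSξ, rfl⟩
      have := h ξ hξ
      simp only [Set.mem_ofPred_eq]
      linarith
    have h1 : c - M ^ 2 ≤ ‖w‖ ^ 2 := hsub hw
    rw [norm_pos_iff]
    rintro rfl
    simp at h1
    linarith
  set d := ‖S‖ with hd
  have hd0 : 0 < d := hM.trans_lt hMS
  have hB : 0 < 2 * ‖w‖ * d + ‖w‖ ^ 2 := by positivity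
  -- With `s ≤ 1`, a vector with `‖S ξ‖ ^ 2 < c` gains at most `s * (2 * ‖w‖ * d + ‖w‖ ^ 2)`, half
  -- the gap `d ^ 2 - c`.
  set s : ℝ := min 1 ((d ^ 2 - c) / (2 * (2 * ‖w‖ * d + ‖w‖ ^ 2))) with hs
  have hs0 : 0 < s := lt_min one_pos (div_pos (sub_pos.2 hc2) (by positivity))
  have hs1 : s ≤ 1 := min_le_left _ _
  have hs2 : s * (2 * (2 * ‖w‖ * d + ‖w‖ ^ 2)) ≤ d ^ 2 - c := by
    rw [← le_div_iff₀ (by positivity)]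
    exact min_le_right _ _
  have hss : s ^ 2 ≤ s := by nlinarith
  have hsw : s ^ 2 * ‖w‖ ^ 2 ≤ s * ‖w‖ ^ 2 := by gcongr
  have hKlt : max (d ^ 2 - s * ‖w‖ ^ 2) ((d ^ 2 + c) / 2) < d ^ 2 :=
    max_lt (by have : 0 < s * ‖w‖ ^ 2 := by positivity
               linarith) (by linarith)
  have hK0 : 0 ≤ max (d ^ 2 - s * ‖w‖ ^ 2) ((d ^ 2 + c) / 2) := le_max_of_le_right (by positivity)
  refine ⟨s * w, lt_of_pow_lt_pow_left₀ 2 hd0.le ((hbound _ _ hK0 fun ξ hξ => ?_).trans_lt hKlt)⟩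
  have hSξ : ‖S ξ‖ ≤ d := by simpa [hξ] using S.le_opNorm ξ
  have hexp : ‖(S - ((s : ℂ) * w) • ContinuousLinearMap.id ℂ H) ξ‖ ^ 2
      = ‖S ξ‖ ^ 2 - 2 * s * (conj w * ⟪ξ, S ξ⟫_ℂ).re + s ^ 2 * ‖w‖ ^ 2 := by
    have := norm_sub_smul_sq S ξ hξ (s * w)
    rw [map_mul, Complex.conj_ofReal, mul_assoc, Complex.re_ofReal_mul, norm_mul, mul_pow,
      Complex.norm_real, Real.norm_eq_abs, sq_abs] at this
    simp only [sub_apply, smul_apply,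
      ContinuousLinearMap.id_apply]
    rw [this]
    ring
  rw [hexp]
  by_cases hcξ : c ≤ ‖S ξ‖ ^ 2
  · apply le_max_of_le_left
    -- As `w` is nearest to 0, the value has real component at least `‖w‖ ^ 2` against `w`, so the
    -- square drops by at least `(2 * s - s ^ 2) * ‖w‖ ^ 2`.
    have h1 := hinner _ (subset_closure ⟨ξ, hξ, hcξ, rfl⟩)
    have h2 : ‖w‖ ^ 2 ≤ (conj w * ⟪ξ, S ξ⟫_ℂ).re := by
      rw [zero_sub, inner_neg_left, inner_sub_right, real_inner_self_eq_norm_sq,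
        Complex.inner, mul_comm] at h1
      linarith
    have h3 : ‖S ξ‖ ^ 2 ≤ d ^ 2 := by gcongr
    have h4 : s * ‖w‖ ^ 2 ≤ s * (conj w * ⟪ξ, S ξ⟫_ℂ).re := by gcongr
    linarith
  · apply le_max_of_le_right
    have h1 : -(‖w‖ * d) ≤ (conj w * ⟪ξ, S ξ⟫_ℂ).re := by
      have h2 : ‖conj w * ⟪ξ, S ξ⟫_ℂ‖ ≤ ‖w‖ * d := by
        rw [norm_mul, RCLike.norm_conj]
        gcongr
        calc ‖⟪ξ, S ξ⟫_ℂ‖ ≤ ‖ξ‖ * ‖S ξ‖ := norm_inner_le_norm _ _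
          _ ≤ d := by rwa [hξ, one_mul]
      exact (abs_le.1 ((Complex.abs_re_le_norm _).trans h2)).1
    have h4 : s * -(‖w‖ * d) ≤ s * (conj w * ⟪ξ, S ξ⟫_ℂ).re := by gcongr
    nlinarith

theorem exists_norm_add_smul_id_le (T : H →L[ℂ] H) {M : ℝ} (hM : 0 ≤ M)
    (h : ∀ ξ : H, ‖ξ‖ = 1 → ‖T ξ - ⟪ξ, T ξ⟫_ℂ • ξ‖ ≤ M) :
    ∃ μ : ℂ, ‖T + μ • ContinuousLinearMap.id ℂ H‖ ≤ M := by
  rcases subsingleton_or_nontrivial H with hH | hH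
  · exact ⟨0, by rw [Subsingleton.elim (T + _) 0, norm_zero]; exact hM⟩
  have hlim : Filter.Tendsto (fun μ : ℂ => ‖T + μ • ContinuousLinearMap.id ℂ H‖)
      (Filter.cocompact ℂ) Filter.atTop := by
    refine Filter.tendsto_atTop_mono (f := fun μ : ℂ => ‖μ‖ - ‖T‖) (fun μ => ?_)
      (Filter.tendsto_atTop_add_const_right _ _ (tendsto_norm_cocompact_atTop (E := ℂ)))
    have h1 := norm_sub_le (T + μ • ContinuousLinearMap.id ℂ H) T
    rw [add_sub_cancel_left, norm_smul, ContinuousLinearMap.norm_id, mul_one] at h1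
    linarith
  obtain ⟨μ, hμ⟩ := Continuous.exists_forall_le (by fun_prop) hlim
  refine ⟨μ, not_lt.1 fun hlt => ?_⟩
  obtain ⟨w, hw⟩ := exists_norm_sub_smul_id_lt _ hM hlt fun ξ hξ => by
    rw [← norm_sub_inner_smul_sq _ ξ hξ]
    -- The defect is unchanged by adding a scalar.
    have h1 : (T + μ • ContinuousLinearMap.id ℂ H) ξ
        - ⟪ξ, (T + μ • ContinuousLinearMap.id ℂ H) ξ⟫_ℂ • ξ = T ξ - ⟪ξ, T ξ⟫_ℂ • ξ := by
      simp [inner_self_eq_norm_sq_to_K, hξ, add_smul]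
    rw [h1]
    gcongr
    exact h ξ hξ
  refine (hμ (μ - w)).not_gt ?_
  rwa [sub_smul, ← add_sub_assoc]

/-! ### Norm of the derivation -/

theorem norm_innerDerivation_le (T : H →L[ℂ] H) (μ : ℂ) :
    ‖innerDerivation T‖ ≤ 2 * ‖T + μ • ContinuousLinearMap.id ℂ H‖ := by
  refine ContinuousLinearMap.opNorm_le_bound _ (by positivity) fun S => ?_
  set A := T + μ • ContinuousLinearMap.id ℂ H with hA
  have h1 : innerDerivation T S = A * S - S * A := by
    ext x
    simp [innerDerivation_apply, hA]
  calc ‖innerDerivation T S‖ ≤ ‖A * S‖ + ‖S * A‖ := by rw [h1]; exact norm_sub_le _ _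
    _ ≤ ‖A‖ * ‖S‖ + ‖S‖ * ‖A‖ := add_le_add (norm_mul_le _ _) (norm_mul_le _ _)
    _ = 2 * ‖A‖ * ‖S‖ := by ring

/-- The derivation is evaluated at the reflection fixing `ξ`. -/
theorem two_mul_norm_sub_inner_smul_le (T : H →L[ℂ] H) {ξ : H} (hξ : ‖ξ‖ = 1) :
    2 * ‖T ξ - ⟪ξ, T ξ⟫_ℂ • ξ‖ ≤ ‖innerDerivation T‖ := by
  let V : H →L[ℂ] H := ((ℂ ∙ ξ).reflection.toContinuousLinearEquiv : H →L[ℂ] H)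
  have hV : ∀ x, V x = (2 : ℂ) • ⟪ξ, x⟫_ℂ • ξ - x := by
    intro x
    change (ℂ ∙ ξ).reflection x = _
    rw [Submodule.reflection_apply, Submodule.starProjection_unit_singleton ℂ hξ, two_smul,
      two_smul]
  have hVn : ‖V‖ ≤ 1 := V.opNorm_le_bound zero_le_one fun x => by
    rw [one_mul]
    exact ((ℂ ∙ ξ).reflection.norm_map x).le
  have h1 : innerDerivation T V ξ = (2 : ℂ) • (T ξ - ⟪ξ, T ξ⟫_ℂ • ξ) := by
    have hVξ : V ξ = ξ := by
      rw [hV, inner_self_eq_norm_sq_to_K, hξ]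
      simp [two_smul]
    change T (V ξ) - V (T ξ) = _
    rw [hVξ, hV, two_smul, two_smul]
    abel
  calc 2 * ‖T ξ - ⟪ξ, T ξ⟫_ℂ • ξ‖ = ‖innerDerivation T V ξ‖ := by rw [h1, norm_smul]; simp
    _ ≤ ‖innerDerivation T V‖ := by simpa [hξ] using (innerDerivation T V).le_opNorm ξ
    _ ≤ ‖innerDerivation T‖ * ‖V‖ := (innerDerivation T).le_opNorm V
    _ ≤ ‖innerDerivation T‖ := mul_le_of_le_one_right (innerDerivation T).opNorm_nonneg hVn

end Variance

theorem mainTheorem4 {H : Type*} [NormedAddCommGroup H] [InnerProductSpace ℂ H] [CompleteSpace H]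
    (T : H →L[ℂ] H) (ε : ℝ) (hε : ε ∈ Set.Ico (0 : ℝ) 1) :
    List.TFAE [
      ApproxParallel ε T (ContinuousLinearMap.id ℂ H),
      sSup {r : ℝ | ∃ ξ : H, ‖ξ‖ = 1 ∧ r = ‖T ξ - (inner ℂ ξ (T ξ) : ℂ) • ξ‖} ≤ ε * ‖T‖,
      sSup {r : ℝ | ∃ ξ : H, ‖ξ‖ = 1 ∧ r = ‖T ξ‖ ^ 2 - ‖(inner ℂ ξ (T ξ) : ℂ)‖ ^ 2}
        ≤ ε ^ 2 * ‖T‖ ^ 2,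
      ‖innerDerivation T‖ ≤ 2 * ε * ‖T‖] := by
  have hεT : 0 ≤ ε * ‖T‖ := mul_nonneg hε.1 (norm_nonneg _)
  have hsup : sSup {r : ℝ | ∃ ξ : H, ‖ξ‖ = 1 ∧ r = ‖T ξ - ⟪ξ, T ξ⟫_ℂ • ξ‖} ≤ ε * ‖T‖ ↔
      ∀ ξ : H, ‖ξ‖ = 1 → ‖T ξ - ⟪ξ, T ξ⟫_ℂ • ξ‖ ≤ ε * ‖T‖ := by
    constructor
    · intro h ξ hξ
      refine h.trans' (le_csSup ⟨‖T‖, ?_⟩ ⟨ξ, hξ, rfl⟩)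
      rintro _ ⟨η, hη, rfl⟩
      exact norm_sub_inner_smul_le T η hη
    · intro h
      -- Nonnegativity of the bound covers `H = 0`, where the supremum is `sSup ∅ = 0`.
      refine Real.sSup_le ?_ hεT
      rintro _ ⟨ξ, hξ, rfl⟩
      exact h ξ hξ
  have hsupsq : sSup {r : ℝ | ∃ ξ : H, ‖ξ‖ = 1 ∧ r = ‖T ξ‖ ^ 2 - ‖⟪ξ, T ξ⟫_ℂ‖ ^ 2}
      ≤ ε ^ 2 * ‖T‖ ^ 2 ↔ ∀ ξ : H, ‖ξ‖ = 1 → ‖T ξ - ⟪ξ, T ξ⟫_ℂ • ξ‖ ≤ ε * ‖T‖ := by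
    rw [← mul_pow]
    constructor
    · intro h ξ hξ
      refine (abs_le_of_sq_le_sq' ?_ hεT).2
      rw [norm_sub_inner_smul_sq T ξ hξ]
      refine h.trans' (le_csSup ⟨‖T‖ ^ 2, ?_⟩ ⟨ξ, hξ, rfl⟩)
      rintro _ ⟨η, hη, rfl⟩
      rw [← norm_sub_inner_smul_sq T η hη]
      gcongr
      exact norm_sub_inner_smul_le T η hη
    · intro h
      refine Real.sSup_le ?_ (sq_nonneg _)
      rintro _ ⟨ξ, hξ, rfl⟩
      rw [← norm_sub_inner_smul_sq T ξ hξ]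
      gcongr
      exact h ξ hξ
  tfae_have 2 ↔ 3 := hsup.trans hsupsq.symm
  tfae_have 1 → 4 := by
    intro h
    have h1 : ‖innerDerivation T‖ / 2 ≤
        sInf {r : ℝ | ∃ μ : ℂ, r = ‖T + μ • ContinuousLinearMap.id ℂ H‖} := by
      refine le_csInf ⟨_, 0, rfl⟩ ?_
      rintro _ ⟨μ, rfl⟩
      linarith [norm_innerDerivation_le T μ]
    have h2 := h1.trans h
    linarith
  tfae_have 4 → 2 := by
    intro h
    refine hsup.2 fun ξ hξ => ?_
    linarith [two_mul_norm_sub_inner_smul_le T hξ]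
  tfae_have 2 → 1 := by
    intro h
    obtain ⟨μ, hμ⟩ := exists_norm_add_smul_id_le T hεT (hsup.1 h)
    unfold ApproxParallel
    refine le_trans (csInf_le ⟨0, ?_⟩ ⟨μ, rfl⟩) hμ
    rintro _ ⟨ν, rfl⟩
    exact norm_nonneg _
  tfae_finish
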